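/- Let $D$ be a Krull domain, that is, an integral domain such that the localization $D_P$ is a discrete valuation ring for every height-one prime ideal $P$ of $D$, $D=\bigcap_P D_P$ inside the quotient field $K$ of $D$ (with $P$ ranging over all height-one primes), and every nonzero element of $D$ lies in only finitely many height-one primes. Suppose that $D$ has a prime element $\pi$ such that $D/\pi D$ is finite, and let $\mathrm{Int}(D)=\{f\in K[X] \mid f(D)\subseteq D\}$ be the ring of integer-valued polynomials on $D$. Then $\mathrm{Int}(D)$ has full system of multisets of lengths, i.e., for all positive integers $k$ and all integers $1<n_1\le\dots\le n_k$ there exists $H\in\mathrm{Int}(D)$ which has precisely $k$ essentially different factorizations into irreducible elements of $\mathrm{Int}(D)$, and the lengths of these $k$ factorizations are exactly $n_1,\dots,n_k$ (counted with multiplicity). Here a factorization of $H$ of length $n$ is a decomposition $H=a_1\cdots a_n$ into irreducible elements $a_i$ of $\mathrm{Int}(D)$, and two factorizations $H=a_1\cdots a_n=u_1\cdots u_m$ are essentially the same if $n=m$ and, after re-indexing, $u_i$ is associated to $a_i$ in $\mathrm{Int}(D)$ for every $i$; otherwise they are essentially different. -/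

import Mathlib

open Polynomial

/-- A Krull domain: an integral domain `D` such that `D_P` is a discrete valuation ring for every
height-one prime `P`, `D` is the intersection of the `D_P` (inside its quotient field), and every
nonzero element of `D` lies in only finitely many height-one primes. (A field is a Krull domain,
with no height-one primes.) -/
structure IsKrullDomain (D : Type*) [CommRing D] [IsDomain D] : Prop where
  isDiscreteValuationRing : ∀ (P : Ideal D) [P.IsPrime], P.height = 1 →
    IsDiscreteValuationRing (Localization.AtPrime P)
  iInf_localization_eq_bot :
    (⨅ P : {P : PrimeSpectrum D // P.asIdeal.height = 1},
      Localization.subalgebra.ofField (FractionRing D) P.1.asIdeal.primeCompl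
        P.1.asIdeal.primeCompl_le_nonZeroDivisors) = ⊥
  finite_heightOne : ∀ a : D, a ≠ 0 →
    {P : Ideal D | P.IsPrime ∧ P.height = 1 ∧ a ∈ P}.Finite

/-- The ring `Int(D) = {f ∈ K[X] | f(D) ⊆ D}` of integer-valued polynomials on `D`, where `K` is the
quotient field of `D`. -/
def integerValuedPolynomials (D K : Type*) [CommRing D] [IsDomain D] [Field K] [Algebra D K]
    [IsFractionRing D K] : Subalgebra D K[X] where
  carrier := {f | ∀ a : D, f.eval (algebraMap D K a) ∈ (algebraMap D K).range}
  mul_mem' {f g} hf hg a := by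
    rw [eval_mul]
    exact mul_mem (hf a) (hg a)
  add_mem' {f g} hf hg a := by
    rw [eval_add]
    exact add_mem (hf a) (hg a)
  algebraMap_mem' r a := by
    rw [Polynomial.algebraMap_apply, eval_C]
    exact ⟨r, rfl⟩

/-- `s` is a factorization of `r`: a decomposition `r = a₁ ⋯ aₙ` into irreducible elements of `R`,
recorded as the multiset of its factors. Its length is `Multiset.card s`. -/
def IsFactorization {R : Type*} [CommRing R] (r : R) (s : Multiset R) : Prop :=
  (∀ a ∈ s, Irreducible a) ∧ s.prod = r

/-- Two factorizations are essentially the same if they have the same length and, after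
re-indexing, corresponding factors are associated. -/
def EssentiallySame {R : Type*} [CommRing R] (s t : Multiset R) : Prop :=
  Multiset.Rel Associated s t

/-- `R` has full system of multisets of lengths: for all `k ≥ 1` and all integers
`1 < n₁ ≤ … ≤ nₖ` there is an element `r` of `R` with factorizations `z₁, …, zₖ` of lengths
`n₁, …, nₖ` which are pairwise essentially different, and such that every factorization of `r` is
essentially the same as one of them. -/
def HasFullSystemOfMultisetsOfLengths (R : Type*) [CommRing R] : Prop :=
  ∀ (k : ℕ), 0 < k → ∀ n : Fin k → ℕ, Monotone n → (∀ i, 1 < n i) →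
    ∃ (r : R) (z : Fin k → Multiset R),
      (∀ i, IsFactorization r (z i) ∧ Multiset.card (z i) = n i) ∧
      (∀ i j, i ≠ j → ¬ EssentiallySame (z i) (z j)) ∧
      (∀ s : Multiset R, IsFactorization r s → ∃ i, EssentiallySame s (z i))

/-! Let Q = D/π^M, a finite ring, and let ι be a finite index set. To each (i, c) in ι × Q belongs a
polynomial u(X-c)^N + wπ^(NM-δ) with N = 3^(L+e i), u and w prime to π, and a correction δ = δ i c
in {1, 2}. It is irreducible over K because NM-δ is not divisible by 3. Its π-adic valuation at a is
N·v(a-c), with v truncated at M, lowered by δ when a ≡ c. With u, w chosen so that the value at 0 is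
a power of π, division by this value brings in no denominator but π. Hence a product of the
normalized polynomials is integer-valued iff its valuation is minimal at 0.

Over a full product set T × Q the main terms add up to a constant, so only the corrections decide
(`totalVal_product_le_iff`); they are chosen so that exactly the `Admissible` sets T survive
(`exists_corrections`). Conversely, if the products over S and over its complement are both
integer-valued, then S is a full product set (`exists_eq_product_of_totalVal_le`): 3^L exceeds all
corrections, the matrix v(a-c) is positive definite, and distinct powers of 3 separate the indices.
With unique factorization in K[X], factorizations of the product over ι × Q thus become partitions
of ι into admissible sets.

Finally ι consists of `none` and, for each κ, a block of n κ - 1 indices. Sets without `none` are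
admissible; a set with `none` is admissible iff its complement lies in one block. The irreducible
factor carrying `none` is therefore the complement of a block, and the rest splits into singletons:
one factorization of length n κ for each κ. -/

/-! ### Multiplicities of a prime element -/

section CommRing

variable {D : Type*} [CommRing D]

/-- The `π`-adic valuation of `x`, truncated at `M`. -/
noncomputable def truncVal (π : D) (M : ℕ) (x : D) : ℕ :=
  open Classical in ∑ j ∈ Finset.range M, if π ^ (j + 1) ∣ x then 1 else 0

theorem truncVal_of_dvd {π : D} {M : ℕ} {x : D} (h : π ^ M ∣ x) : truncVal π M x = M := by
  classical
  rw [truncVal, Finset.sum_congr rfl (g := fun _ => 1)]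
  · simp
  · intro j hj
    rw [if_pos ((pow_dvd_pow π (Finset.mem_range.1 hj)).trans h)]

theorem exists_eq_pow_truncVal_mul {π : D} {M : ℕ} {x : D} (h : ¬ π ^ M ∣ x) :
    truncVal π M x < M ∧ ∃ z, ¬ π ∣ z ∧ x = π ^ truncVal π M x * z := by
  classical
  have hf : FiniteMultiplicity π x := by
    refine ⟨M, fun h' => h ((pow_dvd_pow π (Nat.le_succ M)).trans h')⟩
  have hlt : multiplicity π x < M := by
    by_contra! hle
    exact h ((pow_dvd_pow π hle).trans (pow_multiplicity_dvd π x))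
  have hval : truncVal π M x = multiplicity π x := by
    have : ∀ j ∈ Finset.range M, (if π ^ (j + 1) ∣ x then 1 else 0) =
        if j < multiplicity π x then 1 else 0 := by
      intro j _
      simp only [hf.pow_dvd_iff_le_multiplicity, Nat.succ_le_iff]
    rw [truncVal, Finset.sum_congr rfl this, Finset.sum_boole]
    have : {j ∈ Finset.range M | j < multiplicity π x} = Finset.range (multiplicity π x) := by
      ext j
      simp only [Finset.mem_filter, Finset.mem_range]
      omega
    rw [this]
    simp
  obtain ⟨z, hz, hz'⟩ := hf.exists_eq_pow_mul_and_not_dvd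
  rw [hval]
  exact ⟨hlt, z, hz', hz⟩

theorem exists_mul_add_mul_pow_eq_one {π : D} (hπ : Prime π) (hmax : (Ideal.span {π}).IsMaximal)
    {z : D} (hz : ¬ π ∣ z) (e : ℕ) :
    ∃ u w : D, ¬ π ∣ u ∧ ¬ π ∣ w ∧ u * z + w * π ^ (e + 1) = 1 := by
  have hcop : IsCoprime z (π ^ (e + 1)) := by
    apply IsCoprime.pow_right
    obtain ⟨y, i, hi, h⟩ := hmax.exists_inv (x := z) (by rwa [Ideal.mem_span_singleton])
    obtain ⟨t, rfl⟩ := Ideal.mem_span_singleton.1 hi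
    exact ⟨y, t, by rw [← h]; ring⟩
  obtain ⟨u, w, h⟩ := hcop
  have hunit : ∀ u w : D, u * z + w * π ^ (e + 1) = 1 → ¬ π ∣ u := by
    intro u w h hu
    apply hπ.not_dvd_one
    rw [← h]
    exact dvd_add (hu.mul_right _) ((dvd_pow_self π e.succ_ne_zero).mul_left _)
  by_cases hw : π ∣ w
  · have h' : (u - π ^ (e + 1)) * z + (w + z) * π ^ (e + 1) = 1 := by rw [← h]; ring
    exact ⟨_, _, hunit _ _ h', by rwa [dvd_add_right hw], h'⟩
  · exact ⟨u, w, hunit _ _ h, hw, h⟩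

open Classical in
/-- The valuation at `π` of `u x ^ n + w π ^ (n M - δ)`, where `u` and `w` are prime to `π`. -/
noncomputable def binomVal (π : D) (M n δ : ℕ) (x : D) : ℕ :=
  if π ^ M ∣ x then n * M - δ else n * truncVal π M x

/-- The two summands never have equal valuation: if d < M is the valuation of x, then nd ≤ nM - n <
nM - δ, and otherwise the first is at least nM > nM - δ. -/
theorem binom_eq_pow_mul {π : D} (hπ : Prime π) {M n δ : ℕ} (hM : 0 < M) (hδ : 0 < δ) (hδn : δ < n)
    {u w : D} (hu : ¬ π ∣ u) (hw : ¬ π ∣ w) (x : D) :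
    ∃ y, ¬ π ∣ y ∧ u * x ^ n + w * π ^ (n * M - δ) = π ^ binomVal π M n δ x * y := by
  have hnM : n ≤ n * M := Nat.le_mul_of_pos_right n hM
  by_cases h : π ^ M ∣ x
  · obtain ⟨z, rfl⟩ := h
    refine ⟨w + π ^ δ * (u * z ^ n), ?_, ?_⟩
    · rwa [dvd_add_left ((dvd_pow_self π hδ.ne').mul_right _)]
    · rw [binomVal, if_pos (dvd_mul_right _ _)]
      have : (π ^ M) ^ n = π ^ (n * M - δ) * π ^ δ := by
        rw [← pow_mul, ← pow_add, mul_comm M n, Nat.sub_add_cancel (by omega)]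
      rw [mul_pow, this]
      ring
  · obtain ⟨hlt, z, hz, hx⟩ := exists_eq_pow_truncVal_mul h
    rw [binomVal, if_neg h]
    generalize truncVal π M x = d at *
    have h1 : n * d + n ≤ n * M := by
      calc n * d + n = n * (d + 1) := by ring
        _ ≤ n * M := Nat.mul_le_mul_left n hlt
    obtain ⟨e, he⟩ : ∃ e, n * M - δ = n * d + (e + 1) := ⟨n * M - δ - n * d - 1, by omega⟩
    refine ⟨u * z ^ n + π * (w * π ^ e), ?_, ?_⟩
    · rw [dvd_add_left (dvd_mul_right _ _)]
      intro hd
      rcases hπ.dvd_or_dvd hd with hd | hd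
      exacts [hu hd, hz (hπ.dvd_of_dvd_pow hd)]
    · rw [hx, he, mul_pow, ← pow_mul, mul_comm d n, pow_add, pow_succ]
      ring

/-- This serves to normalize at 0: the value is an exact power of π, without a cofactor that could
be a non-unit of D. Away from the multiples of π^M the coefficients come from Bézout. -/
theorem exists_binom_eq_pow {π : D} (hπ : Prime π) (hmax : (Ideal.span {π}).IsMaximal)
    {M n δ : ℕ} (hM : 0 < M) (hδ : 0 < δ) (hδn : δ < n) (x : D) :
    ∃ u w : D, ¬ π ∣ u ∧ ¬ π ∣ w ∧
      u * x ^ n + w * π ^ (n * M - δ) = π ^ binomVal π M n δ x := by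
  have hnM : n ≤ n * M := Nat.le_mul_of_pos_right n hM
  by_cases h : π ^ M ∣ x
  · obtain ⟨z, rfl⟩ := h
    refine ⟨1, 1 - π ^ δ * z ^ n, hπ.not_dvd_one, ?_, ?_⟩
    · rw [dvd_sub_left ((dvd_pow_self π hδ.ne').mul_right _)]
      exact hπ.not_dvd_one
    · rw [binomVal, if_pos (dvd_mul_right _ _)]
      have : (π ^ M) ^ n = π ^ (n * M - δ) * π ^ δ := by
        rw [← pow_mul, ← pow_add, mul_comm M n, Nat.sub_add_cancel (by omega)]
      rw [mul_pow, this]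
      ring
  · obtain ⟨hlt, z, hz, hx⟩ := exists_eq_pow_truncVal_mul h
    rw [binomVal, if_neg h]
    generalize truncVal π M x = d at *
    have h1 : n * d + n ≤ n * M := by
      calc n * d + n = n * (d + 1) := by ring
        _ ≤ n * M := Nat.mul_le_mul_left n hlt
    obtain ⟨e, he⟩ : ∃ e, n * M - δ = n * d + (e + 1) := ⟨n * M - δ - n * d - 1, by omega⟩
    obtain ⟨u, w, hu, hw, h2⟩ := exists_mul_add_mul_pow_eq_one hπ hmax
      (fun h => hz (hπ.dvd_of_dvd_pow h) : ¬ π ∣ z ^ n) e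
    refine ⟨u, w, hu, hw, ?_⟩
    rw [hx, he, mul_pow, ← pow_mul, mul_comm d n, pow_add]
    linear_combination π ^ (n * d) * h2

end CommRing

/-! ### Finite π-adic multiplicities in a Krull domain and irreducible binomials -/

section PrimeElement

variable {D : Type*} [CommRing D] [IsDomain D]

/-- Otherwise 1/π lies in every localization at a height-one prime, hence in D. -/
theorem IsKrullDomain.exists_heightOne_mem (hD : IsKrullDomain D) {π : D} (hπ : Prime π) :
    ∃ P : Ideal D, ∃ _ : P.IsPrime, P.height = 1 ∧ π ∈ P := by
  by_contra! h
  have hmem : (algebraMap D (FractionRing D) π)⁻¹ ∈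
      (⊥ : Subalgebra D (FractionRing D)) := by
    rw [← hD.iInf_localization_eq_bot, Algebra.mem_iInf]
    intro P
    exact ⟨1, π, h P.1.asIdeal P.1.isPrime P.2, by simp⟩
  obtain ⟨y, hy⟩ := Algebra.mem_bot.1 hmem
  have h0 : algebraMap D (FractionRing D) π ≠ 0 := by
    simpa using hπ.ne_zero
  apply hπ.not_isUnit
  refine IsUnit.of_mul_eq_one y ?_
  apply IsFractionRing.injective D (FractionRing D)
  rw [map_mul, hy, map_one, mul_inv_cancel₀ h0]

theorem IsKrullDomain.finiteMultiplicity (hD : IsKrullDomain D) {π : D} (hπ : Prime π) {x : D}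
    (hx : x ≠ 0) : FiniteMultiplicity π x := by
  obtain ⟨P, hP, hP1, hπP⟩ := hD.exists_heightOne_mem hπ
  have := hD.isDiscreteValuationRing P hP1
  have hinj : Function.Injective (algebraMap D (Localization.AtPrime P)) :=
    IsLocalization.injective _ P.primeCompl_le_nonZeroDivisors
  have hfin : FiniteMultiplicity (algebraMap D (Localization.AtPrime P) π)
      (algebraMap D (Localization.AtPrime P) x) := by
    refine FiniteMultiplicity.of_not_isUnit ?_ ?_
    · rw [IsLocalization.AtPrime.isUnit_to_map_iff (Localization.AtPrime P) P]
      exact fun h => h hπP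
    · rwa [Ne, map_eq_zero_iff _ hinj]
  obtain ⟨n, hn⟩ := hfin
  refine ⟨n, fun h => hn ?_⟩
  rw [← map_pow]
  exact map_dvd _ h

/-- The π-adic valuations of the two sides differ modulo 3. So no ratio ±wπ^m/u is a cube in K. -/
theorem cube_mul_ne_of_not_dvd (hD : IsKrullDomain D) {π u w x y : D} (hπ : Prime π)
    (hu : ¬ π ∣ u) (hw : ¬ π ∣ w) (hy : y ≠ 0) {m : ℕ} (hm : ¬ 3 ∣ m) :
    x ^ 3 * u ≠ y ^ 3 * (w * π ^ m) := by
  intro h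
  have hw0 : w ≠ 0 := fun h0 => hw (h0 ▸ dvd_zero π)
  have hx : x ≠ 0 := by
    rintro rfl
    have := mul_ne_zero (pow_ne_zero 3 hy) (mul_ne_zero hw0 (pow_ne_zero m hπ.ne_zero))
    exact this (by rw [← h]; ring)
  have h1 := congrArg (emultiplicity π) h
  rw [emultiplicity_mul hπ, emultiplicity_mul hπ, emultiplicity_mul hπ, emultiplicity_pow hπ,
    emultiplicity_pow hπ, emultiplicity_pow_self_of_prime hπ, emultiplicity_eq_zero.2 hu,
    emultiplicity_eq_zero.2 hw,
    (hD.finiteMultiplicity hπ hx).emultiplicity_eq_multiplicity,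
    (hD.finiteMultiplicity hπ hy).emultiplicity_eq_multiplicity] at h1
  norm_cast at h1
  omega

variable {K : Type*} [Field K] [Algebra D K] [IsFractionRing D K]

theorem irreducible_shifted_binom (hD : IsKrullDomain D) {π : D} (hπ : Prime π) {u w : D}
    (hu : ¬ π ∣ u) (hw : ¬ π ∣ w) {m : ℕ} (hm : ¬ 3 ∣ m) (l : ℕ) (c : D) :
    Irreducible (C (algebraMap D K u) * (X - C (algebraMap D K c)) ^ 3 ^ l +
      C (algebraMap D K (w * π ^ m))) := by
  have hinj := IsFractionRing.injective D K
  have hu0 : algebraMap D K u ≠ 0 := by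
    rw [Ne, map_eq_zero_iff _ hinj]
    rintro rfl
    exact hu (dvd_zero π)
  have key : Irreducible (X ^ 3 ^ l - C (-(algebraMap D K (w * π ^ m) / algebraMap D K u))) := by
    refine X_pow_sub_C_irreducible_of_prime_pow Nat.prime_three (by norm_num) l fun b hb => ?_
    obtain ⟨x, y, hy, rfl⟩ := IsFractionRing.div_surjective D b
    have hy0 : algebraMap D K y ≠ 0 := by
      rw [Ne, map_eq_zero_iff _ hinj]
      exact nonZeroDivisors.ne_zero hy
    -- The sign is absorbed because -1 is a cube.
    apply cube_mul_ne_of_not_dvd hD hπ hu hw (nonZeroDivisors.ne_zero hy) hm (x := -x)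
    apply hinj
    simp only [map_mul, map_pow, map_neg] at hb ⊢
    field_simp at hb
    linear_combination -hb
  rw [← MulEquiv.irreducible_iff (taylorEquiv (-algebraMap D K c))] at key
  have hC : IsUnit (C (algebraMap D K u)) := by
    rw [isUnit_C]
    exact hu0.isUnit
  rw [← irreducible_isUnit_mul hC] at key
  convert key using 1
  have hCm : C (algebraMap D K (w * π ^ m)) =
      C (algebraMap D K u) * C (algebraMap D K (w * π ^ m) / algebraMap D K u) := by
    rw [← C_mul, mul_div_cancel₀ _ hu0]
  rw [hCm]
  simp [taylorEquiv, taylor_apply, mul_add, ← sub_eq_add_neg]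

/-- Irreducible polynomials over `K` whose valuation at `π` is a truncated multiple of the
`π`-adic distance to `c`, normalized by the value `1` at `0`. -/
theorem exists_irreducible_binomVal (hD : IsKrullDomain D) {π : D} (hπ : Prime π)
    (hmax : (Ideal.span {π}).IsMaximal) {M l δ : ℕ} (hM : 0 < M) (hl : 0 < l) (hδ : 0 < δ)
    (hδ3 : δ < 3) (c : D) :
    ∃ g : K[X], Irreducible g ∧ g.natDegree = 3 ^ l ∧ g.eval 0 = 1 ∧
      ∀ a : D, ∃ y : D, ¬ π ∣ y ∧
        g.eval (algebraMap D K a) * algebraMap D K (π ^ binomVal π M (3 ^ l) δ (0 - c)) =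
          algebraMap D K (π ^ binomVal π M (3 ^ l) δ (a - c) * y) := by
  have hinj := IsFractionRing.injective D K
  have h3l : 3 ≤ 3 ^ l := Nat.le_self_pow hl.ne' 3
  have hn : 3 ^ l ≤ 3 ^ l * M := Nat.le_mul_of_pos_right _ hM
  have h3 : 3 ∣ 3 ^ l * M := (dvd_pow_self 3 hl.ne').mul_right M
  obtain ⟨u, w, hu, hw, h0⟩ := exists_binom_eq_pow hπ hmax hM hδ (hδ3.trans_le h3l) (0 - c)
  have hirr := irreducible_shifted_binom (K := K) hD hπ hu hw
    (m := 3 ^ l * M - δ) (by omega) l c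
  set p := C (algebraMap D K u) * (X - C (algebraMap D K c)) ^ 3 ^ l +
      C (algebraMap D K (w * π ^ (3 ^ l * M - δ))) with hp
  have hu0 : algebraMap D K u ≠ 0 := by
    rw [Ne, map_eq_zero_iff _ hinj]
    rintro rfl
    exact hu (dvd_zero π)
  have heval : ∀ a : D, p.eval (algebraMap D K a) =
      algebraMap D K (u * (a - c) ^ 3 ^ l + w * π ^ (3 ^ l * M - δ)) := by
    intro a
    simp [hp]
  have hdeg : p.natDegree = 3 ^ l := by
    rw [hp, natDegree_add_C, natDegree_C_mul hu0, natDegree_pow, natDegree_X_sub_C, mul_one]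
  set t := algebraMap D K (π ^ binomVal π M (3 ^ l) δ (0 - c)) with ht
  have ht0 : t ≠ 0 := by
    rw [ht, Ne, map_eq_zero_iff _ hinj]
    exact pow_ne_zero _ hπ.ne_zero
  refine ⟨C t⁻¹ * p, ?_, ?_, ?_, fun a => ?_⟩
  · rwa [irreducible_isUnit_mul (isUnit_C.2 (inv_ne_zero ht0).isUnit)]
  · rw [natDegree_C_mul (inv_ne_zero ht0), hdeg]
  · have := heval 0
    rw [map_zero, h0] at this
    rw [eval_mul, eval_C, this, inv_mul_cancel₀ ht0]
  · obtain ⟨y, hy, h⟩ := binom_eq_pow_mul hπ hM hδ (hδ3.trans_le h3l) hu hw (a - c)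
    refine ⟨y, hy, ?_⟩
    rw [← h, ← heval, eval_mul, eval_C]
    field_simp

end PrimeElement

/-! ### Truncated valuations on a finite quotient -/

section FiniteQuotient

theorem truncVal_mk {D : Type*} [CommRing D] (π : D) (M : ℕ) (x : D) :
    truncVal (Ideal.Quotient.mk (Ideal.span {π ^ M}) π) M (Ideal.Quotient.mk _ x) =
      truncVal π M x := by
  classical
  rw [truncVal, truncVal]
  refine Finset.sum_congr rfl fun j hj => ?_
  have hiff : Ideal.Quotient.mk (Ideal.span {π ^ M}) π ^ (j + 1) ∣
      Ideal.Quotient.mk (Ideal.span {π ^ M}) x ↔ π ^ (j + 1) ∣ x := by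
    constructor
    · rintro ⟨z, hz⟩
      obtain ⟨z, rfl⟩ := Ideal.Quotient.mk_surjective z
      rw [← map_pow, ← map_mul, Ideal.Quotient.mk_eq_mk_iff_sub_mem,
        Ideal.mem_span_singleton] at hz
      have := (pow_dvd_pow π (Finset.mem_range.1 hj)).trans hz
      rwa [dvd_sub_left (dvd_mul_right _ _)] at this
    · intro h
      rw [← map_pow]
      exact map_dvd _ h
  simp only [hiff]

theorem mk_pow_self {D : Type*} [CommRing D] (π : D) (M : ℕ) :
    Ideal.Quotient.mk (Ideal.span {π ^ M}) π ^ M = 0 := by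
  rw [← map_pow, Ideal.Quotient.eq_zero_iff_mem]
  exact Ideal.mem_span_singleton_self _

theorem binomVal_mk {D : Type*} [CommRing D] (π : D) (M n δ : ℕ) (x : D) :
    binomVal (Ideal.Quotient.mk (Ideal.span {π ^ M}) π) M n δ (Ideal.Quotient.mk _ x) =
      binomVal π M n δ x := by
  classical
  have hiff : Ideal.Quotient.mk (Ideal.span {π ^ M}) π ^ M ∣
      Ideal.Quotient.mk (Ideal.span {π ^ M}) x ↔ π ^ M ∣ x := by
    rw [mk_pow_self, zero_dvd_iff, Ideal.Quotient.eq_zero_iff_mem, Ideal.mem_span_singleton]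
  simp only [binomVal, hiff, truncVal_mk]

/-- The quadratic form of an equivalence relation is the sum of the squares of the class sums. -/
theorem sum_sum_mul_ite_nonneg {α β : Type*} [Fintype α] [Fintype β] [DecidableEq β]
    (f : α → β) (y : α → ℚ) :
    0 ≤ ∑ a, ∑ c, y a * y c * (if f a = f c then 1 else 0) := by
  have : ∑ a, ∑ c, y a * y c * (if f a = f c then 1 else 0) =
      ∑ b, (∑ a, if f a = b then y a else 0) ^ 2 := by
    simp_rw [sq, Finset.sum_mul_sum]
    symm
    rw [Finset.sum_comm]
    refine Finset.sum_congr rfl fun a _ => ?_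
    rw [Finset.sum_comm]
    refine Finset.sum_congr rfl fun c _ => ?_
    rw [Finset.sum_eq_single (f a)]
    · by_cases h : f a = f c
      · simp [h]
      · simp [h, Ne.symm h]
    · intro b _ hb
      rw [if_neg hb.symm, zero_mul]
    · simp
  rw [this]
  exact Finset.sum_nonneg fun _ _ => sq_nonneg _

variable {Q : Type*} [CommRing Q] {t : Q} {M : ℕ}

theorem binomVal_cast [DecidableEq Q] (ht : t ^ M = 0) {n δ : ℕ} (h : δ ≤ n * M) (x : Q) :
    (binomVal t M n δ x : ℤ) = n * truncVal t M x - if x = 0 then (δ : ℤ) else 0 := by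
  simp only [binomVal, ht, zero_dvd_iff]
  by_cases hx : x = 0
  · rw [if_pos hx, if_pos hx, truncVal_of_dvd (hx ▸ dvd_zero _)]
    push_cast [h]
    ring
  · rw [if_neg hx, if_neg hx]
    push_cast
    ring

variable {ι : Type*}

/-- The total valuation at `a` of the polynomials with indices in `S`. -/
noncomputable def totalVal (t : Q) (M : ℕ) (n : ι → ℕ) (δ : ι → Q → ℕ) (S : Finset (ι × Q))
    (a : Q) : ℕ :=
  ∑ p ∈ S, binomVal t M (n p.1) (δ p.1 p.2) (a - p.2)

theorem totalVal_cast [DecidableEq Q] (ht : t ^ M = 0) {n : ι → ℕ} {δ : ι → Q → ℕ}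
    (h : ∀ i c, δ i c ≤ n i * M) (S : Finset (ι × Q)) (a : Q) :
    (totalVal t M n δ S a : ℤ) = ((∑ p ∈ S, n p.1 * truncVal t M (a - p.2) : ℕ) : ℤ) -
      ((∑ p ∈ S, if a = p.2 then δ p.1 p.2 else 0 : ℕ) : ℤ) := by
  rw [totalVal, Nat.cast_sum, Nat.cast_sum, Nat.cast_sum, ← Finset.sum_sub_distrib]
  refine Finset.sum_congr rfl fun p _ => ?_
  rw [binomVal_cast ht (h p.1 p.2)]
  simp only [sub_eq_zero]
  push_cast
  rfl

variable [Fintype Q]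

/-- The matrix v(a-c) is the sum over j < M of the indicator matrices of congruence modulo t^(j+1).
Each is positive semidefinite, and the last is the identity since t^M = 0, so the sum is positive
definite. -/
theorem eq_zero_of_sum_mul_truncVal_eq_zero (hM : 0 < M) (ht : t ^ M = 0) (y : Q → ℚ)
    (h : ∀ a, ∑ c, y c * truncVal t M (a - c) = 0) (a : Q) : y a = 0 := by
  classical
  have hterm : ∀ j, 0 ≤ ∑ a, ∑ c, y a * y c * (if t ^ (j + 1) ∣ a - c then 1 else 0) := by
    intro j
    have : Fintype (Q ⧸ Ideal.span {t ^ (j + 1)}) := Fintype.ofFinite _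
    have := sum_sum_mul_ite_nonneg (Ideal.Quotient.mk (Ideal.span {t ^ (j + 1)})) y
    simpa only [Ideal.Quotient.mk_eq_mk_iff_sub_mem, Ideal.mem_span_singleton] using this
  have hsum : ∑ j ∈ Finset.range M,
      ∑ a, ∑ c, y a * y c * (if t ^ (j + 1) ∣ a - c then 1 else 0) = 0 := by
    calc _ = ∑ a, y a * ∑ c, y c * truncVal t M (a - c) := by
          rw [Finset.sum_comm]
          refine Finset.sum_congr rfl fun a _ => ?_
          rw [Finset.sum_comm, Finset.mul_sum]
          refine Finset.sum_congr rfl fun c _ => ?_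
          rw [← Finset.mul_sum, truncVal]
          push_cast
          ring
      _ = 0 := by simp [h]
  rw [Finset.sum_eq_zero_iff_of_nonneg fun j _ => hterm j] at hsum
  have hlast := hsum (M - 1) (Finset.mem_range.2 (by omega))
  rw [Nat.sub_add_cancel hM, ht] at hlast
  simp only [zero_dvd_iff, sub_eq_zero, mul_ite, mul_one, mul_zero, Finset.sum_ite_eq,
    Finset.mem_univ, if_true] at hlast
  rw [Finset.sum_eq_zero_iff_of_nonneg fun a _ => mul_self_nonneg _] at hlast
  exact mul_self_eq_zero.1 (hlast a (Finset.mem_univ a))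

theorem sum_truncVal_sub (a : Q) :
    ∑ c, truncVal t M (a - c) = ∑ c, truncVal t M c :=
  (Equiv.subLeft a).sum_comp (truncVal t M)

/-- All row sums of the matrix v(a-c) equal the same nonzero number, so subtracting a suitable
constant s from x gives a vector in its trivial kernel. -/
theorem eq_of_sum_mul_truncVal_const (hM : 0 < M) (ht : t ^ M = 0) (x : Q → ℕ)
    (h : ∀ a, ∑ c, x c * truncVal t M (a - c) = ∑ c, x c * truncVal t M (0 - c)) (a b : Q) :
    x a = x b := by
  have hW : ((∑ c, truncVal t M c : ℕ) : ℚ) ≠ 0 := by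
    have : M ≤ ∑ c, truncVal t M c := by
      calc M = truncVal t M 0 := (truncVal_of_dvd (dvd_zero _)).symm
        _ ≤ _ := Finset.single_le_sum (f := truncVal t M) (fun _ _ => Nat.zero_le _)
          (Finset.mem_univ 0)
    exact_mod_cast (by omega)
  set s : ℚ := ((∑ c, x c * truncVal t M (0 - c) : ℕ) : ℚ) / ((∑ c, truncVal t M c : ℕ) : ℚ)
    with hs
  have key : ∀ a, (x a : ℚ) - s = 0 := by
    refine eq_zero_of_sum_mul_truncVal_eq_zero hM ht (fun a => (x a : ℚ) - s) fun a => ?_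
    have h1 : ((∑ c, x c * truncVal t M (a - c) : ℕ) : ℚ) = _ := congrArg _ (h a)
    have h2 : ((∑ c, truncVal t M (a - c) : ℕ) : ℚ) = _ := congrArg _ (sum_truncVal_sub a)
    rw [← sub_eq_zero, ← div_mul_cancel₀ ((∑ c, x c * truncVal t M (0 - c) : ℕ) : ℚ) hW, ← hs,
      ← h2] at h1
    rw [← h1]
    push_cast
    rw [Finset.mul_sum, ← Finset.sum_sub_distrib]
    exact Finset.sum_congr rfl fun c _ => by ring
  have := (sub_eq_zero.1 (key a)).trans (sub_eq_zero.1 (key b)).symm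
  exact_mod_cast this

theorem sum_product_mul_truncVal (n : ι → ℕ) (T : Finset ι) (a : Q) :
    ∑ p ∈ T ×ˢ (Finset.univ : Finset Q), n p.1 * truncVal t M (a - p.2) =
      (∑ i ∈ T, n i) * ∑ c, truncVal t M c := by
  rw [Finset.sum_product, Finset.sum_mul]
  refine Finset.sum_congr rfl fun i _ => ?_
  rw [← sum_truncVal_sub a, Finset.mul_sum]

theorem totalVal_product_le_iff (ht : t ^ M = 0) {n : ι → ℕ} {δ : ι → Q → ℕ}
    (h : ∀ i c, δ i c ≤ n i * M) (T : Finset ι) (a : Q) :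
    totalVal t M n δ (T ×ˢ Finset.univ) 0 ≤ totalVal t M n δ (T ×ˢ Finset.univ) a ↔
      ∑ i ∈ T, δ i a ≤ ∑ i ∈ T, δ i 0 := by
  classical
  have key : ∀ a, (totalVal t M n δ (T ×ˢ Finset.univ) a : ℤ) =
      (((∑ i ∈ T, n i) * ∑ c, truncVal t M c : ℕ) : ℤ) - ((∑ i ∈ T, δ i a : ℕ) : ℤ) := by
    intro a
    rw [totalVal_cast ht h, sum_product_mul_truncVal, Finset.sum_product]
    simp
  have e1 := key 0
  have e2 := key a
  omega

/-- The main terms of S and of its complement have a sum independent of a, so the two inequalities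
bound the variation of the main term of S from both sides by the corrections. Being a multiple of
3^L, this variation vanishes. -/
theorem exists_eq_product_of_totalVal_le [Fintype ι] (hM : 0 < M) (ht : t ^ M = 0) {L : ℕ} {e : ι → ℕ}
    (he : Function.Injective e) {δ : ι → Q → ℕ} (hL : 2 * Fintype.card ι < 3 ^ L)
    (hδ : ∀ i c, δ i c ≤ 2) [DecidableEq ι] [DecidableEq Q] {S : Finset (ι × Q)}
    (h1 : ∀ a, totalVal t M (fun i => 3 ^ (L + e i)) δ S 0 ≤
      totalVal t M (fun i => 3 ^ (L + e i)) δ S a)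
    (h2 : ∀ a, totalVal t M (fun i => 3 ^ (L + e i)) δ Sᶜ 0 ≤
      totalVal t M (fun i => 3 ^ (L + e i)) δ Sᶜ a) :
    ∃ T : Finset ι, S = T ×ˢ Finset.univ := by
  set n : ι → ℕ := fun i => 3 ^ (L + e i) with hn
  have hle : ∀ i c, δ i c ≤ n i * M := by
    intro i c
    have : 3 ^ L ≤ n i := Nat.pow_le_pow_right (by norm_num) (Nat.le_add_right L (e i))
    have h3 : n i ≤ n i * M := Nat.le_mul_of_pos_right _ hM
    have := hδ i c
    have : 0 < Fintype.card ι := Fintype.card_pos_iff.2 ⟨i⟩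
    omega
  have hbound : ∀ (S : Finset (ι × Q)) (a : Q),
      ∑ p ∈ S, (if a = p.2 then δ p.1 p.2 else 0) ≤ 2 * Fintype.card ι := by
    intro S a
    calc ∑ p ∈ S, (if a = p.2 then δ p.1 p.2 else 0)
        ≤ ∑ p : ι × Q, (if a = p.2 then δ p.1 p.2 else 0) :=
          Finset.sum_le_sum_of_subset (Finset.subset_univ S)
      _ = ∑ i, δ i a := by
          rw [Fintype.sum_prod_type]
          simp
      _ ≤ ∑ _i : ι, 2 := Finset.sum_le_sum fun i _ => hδ i a
      _ = 2 * Fintype.card ι := by simp [mul_comm]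
  have hZ : ∀ a, ∑ p ∈ S, n p.1 * truncVal t M (a - p.2) =
      ∑ p ∈ S, n p.1 * truncVal t M (0 - p.2) := by
    intro a
    have hdvd : ∀ a, 3 ^ L ∣ ∑ p ∈ S, n p.1 * truncVal t M (a - p.2) := by
      intro a
      refine Finset.dvd_sum fun p _ => Dvd.dvd.mul_right ?_ _
      exact pow_dvd_pow 3 (Nat.le_add_right L (e p.1))
    have htot : ∀ a, ∑ p ∈ S, n p.1 * truncVal t M (a - p.2) +
        ∑ p ∈ Sᶜ, n p.1 * truncVal t M (a - p.2) = (∑ i, n i) * ∑ c, truncVal t M c := by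
      intro a
      rw [Finset.sum_add_sum_compl, ← sum_product_mul_truncVal n Finset.univ a,
        Finset.univ_product_univ]
    have e1 := Nat.cast_le (α := ℤ).2 (h1 a)
    have e2 := Nat.cast_le (α := ℤ).2 (h2 a)
    rw [totalVal_cast ht hle, totalVal_cast ht hle] at e1 e2
    have e3 := (htot a).trans (htot 0).symm
    have b1 := hbound S 0
    have b2 := hbound Sᶜ 0
    have hd : ((3 ^ L : ℕ) : ℤ) ∣ ((∑ p ∈ S, n p.1 * truncVal t M (a - p.2) : ℕ) : ℤ) -
        ((∑ p ∈ S, n p.1 * truncVal t M (0 - p.2) : ℕ) : ℤ) :=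
      dvd_sub (Int.natCast_dvd_natCast.2 (hdvd a)) (Int.natCast_dvd_natCast.2 (hdvd 0))
    have := Int.eq_zero_of_abs_lt_dvd hd (by rw [abs_lt]; constructor <;> omega)
    omega
  have hx := eq_of_sum_mul_truncVal_const hM ht
    (fun c => ∑ i ∈ Finset.univ.filter (fun i => (i, c) ∈ S), n i) ?_
  · have hset : ∀ c, Finset.univ.filter (fun i => (i, c) ∈ S) =
        Finset.univ.filter (fun i => (i, (0 : Q)) ∈ S) := by
      intro c
      have h := hx c 0
      simp only [hn, pow_add, ← Finset.mul_sum] at h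
      -- The fibres of S over c and over 0 have equal weight; uniqueness of base-3 expansions with
      -- digits 0 and 1 makes them equal.
      have h := Nat.eq_of_mul_eq_mul_left (by positivity) h
      rw [← Finset.sum_image (g := e) (f := fun j => 3 ^ j) (fun _ _ _ _ h => he h),
        ← Finset.sum_image (g := e) (f := fun j => 3 ^ j) (fun _ _ _ _ h => he h)] at h
      exact Finset.image_injective he (Finset.geomSum_injective (by norm_num) h)
    refine ⟨Finset.univ.filter (fun i => (i, (0 : Q)) ∈ S), ?_⟩
    ext ⟨i, c⟩
    rw [Finset.mem_product, ← hset c]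
    simp
  · intro a
    have hsum : ∀ a, ∑ c, (∑ i ∈ Finset.univ.filter (fun i => (i, c) ∈ S), n i) *
        truncVal t M (a - c) = ∑ p ∈ S, n p.1 * truncVal t M (a - p.2) := by
      intro a
      have hS : S = Finset.univ.filter (· ∈ S) := by simp
      conv_rhs => rw [hS, Finset.sum_filter, Fintype.sum_prod_type_right]
      refine Finset.sum_congr rfl fun c _ => ?_
      rw [Finset.sum_mul, Finset.sum_filter]
    rw [hsum, hsum, hZ]

end FiniteQuotient

/-! ### Factorizations described by finite sets -/

section Combinatorics

variable {k : ℕ} {n : Fin k → ℕ}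

/-- A set of indices containing `none` is admissible if it meets every pair of indices from
different blocks; all other sets of indices are admissible. -/
def Admissible (T : Finset (Option (Σ κ : Fin k, Fin (n κ - 1)))) : Prop :=
  none ∈ T → ∀ i j : Σ κ : Fin k, Fin (n κ - 1), i.1 ≠ j.1 → some i ∈ T ∨ some j ∈ T

/-- The indices in the block `κ`. -/
def block (n : Fin k → ℕ) (κ : Fin k) : Finset (Option (Σ κ : Fin k, Fin (n κ - 1))) :=
  Finset.univ.map ⟨fun i : Fin (n κ - 1) => some ⟨κ, i⟩, fun i j h => by simpa using h⟩

theorem mem_block {κ : Fin k} {i : Σ κ : Fin k, Fin (n κ - 1)} :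
    some i ∈ block n κ ↔ i.1 = κ := by
  constructor
  · intro h
    obtain ⟨j, -, hj⟩ := Finset.mem_map.1 h
    have : (⟨κ, j⟩ : Σ κ : Fin k, Fin (n κ - 1)) = i := Option.some.inj hj
    rw [← this]
  · rintro rfl
    exact Finset.mem_map.2 ⟨i.2, Finset.mem_univ _, rfl⟩

theorem none_notMem_block {κ : Fin k} : none ∉ block n κ := by
  simp [block]

theorem admissible_of_none_notMem {T : Finset (Option (Σ κ : Fin k, Fin (n κ - 1)))}
    (h : none ∉ T) : Admissible T := fun h' => absurd h' h

theorem admissible_compl_of_subset_block {T : Finset (Option (Σ κ : Fin k, Fin (n κ - 1)))}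
    {κ : Fin k} (h : T ⊆ block n κ) : Admissible Tᶜ := by
  intro _ i j hij
  simp only [Finset.mem_compl]
  by_contra! h'
  exact hij ((mem_block.1 (h h'.1)).trans (mem_block.1 (h h'.2)).symm)

theorem exists_compl_subset_block (hk : 0 < k)
    {T : Finset (Option (Σ κ : Fin k, Fin (n κ - 1)))} (hT : Admissible T) (h : none ∈ T) :
    ∃ κ, Tᶜ ⊆ block n κ := by
  by_cases hne : ∃ i, some i ∉ T
  · obtain ⟨i, hi⟩ := hne
    refine ⟨i.1, fun j hj => ?_⟩
    rw [Finset.mem_compl] at hj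
    match j, hj with
    | none, hj => exact absurd h hj
    | some j, hj =>
      rw [mem_block]
      by_contra hij
      rcases hT h j i hij with h' | h'
      exacts [hj h', hi h']
  · push Not at hne
    refine ⟨⟨0, hk⟩, fun j hj => ?_⟩
    rw [Finset.mem_compl] at hj
    match j, hj with
    | none, hj => exact absurd h hj
    | some j, hj => exact absurd (hne j) hj

theorem block_nonempty (hn : ∀ κ, 1 < n κ) (κ : Fin k) : (block n κ).Nonempty := by
  refine ⟨some ⟨κ, ⟨0, ?_⟩⟩, mem_block.2 rfl⟩
  have := hn κ
  omega

theorem block_injective (hn : ∀ κ, 1 < n κ) : Function.Injective (block n) := by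
  intro κ κ' h
  obtain ⟨i, hi⟩ := block_nonempty hn κ
  have hi' := h ▸ hi
  match i, hi, hi' with
  | none, hi, _ => exact absurd hi none_notMem_block
  | some i, hi, hi' => exact (mem_block.1 hi).symm.trans (mem_block.1 hi')

/-- A relation `Rep a T` expressing that `a` is, up to units, the element of `R` attached to the
finite set `T`; the elements attached to admissible sets multiply by disjoint unions, and
factorizations come from partitions as long as the complement is admissible. -/
structure IsSetRepresentation {R : Type*} [CommRing R]
    (Rep : R → Finset (Option (Σ κ : Fin k, Fin (n κ - 1))) → Prop) : Prop where
  exists_rep : ∀ T, Admissible T → ∃ a, Rep a T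
  admissible : ∀ {a T}, Rep a T → Admissible T
  rep_iff : ∀ {a b T}, Rep a T → (Rep b T ↔ Associated a b)
  inj : ∀ {a T T'}, Rep a T → Rep a T' → T = T'
  one : Rep 1 ∅
  mul : ∀ {a b T T'}, Rep a T → Rep b T' → Disjoint T T' → Rep (a * b) (T ∪ T')
  split : ∀ {a b T}, Rep (a * b) T → Admissible Tᶜ → ∃ T₁ ⊆ T, Rep a T₁ ∧ Rep b (T \ T₁)

namespace IsSetRepresentation

variable {R : Type*} [CommRing R] {Rep : R → Finset (Option (Σ κ : Fin k, Fin (n κ - 1))) → Prop}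
  (hR : IsSetRepresentation Rep)

include hR

theorem isUnit_iff {a : R} {T} (ha : Rep a T) : IsUnit a ↔ T = ∅ := by
  constructor
  · intro h
    refine hR.inj ha ?_
    rw [hR.rep_iff hR.one]
    exact (associated_one_iff_isUnit.2 h).symm
  · rintro rfl
    exact associated_one_iff_isUnit.1 ((hR.rep_iff ha).1 hR.one)

theorem irreducible_iff {a : R} {T} (ha : Rep a T) (hT : Admissible Tᶜ) :
    Irreducible a ↔ T ≠ ∅ ∧
      ∀ T₁ ⊆ T, Admissible T₁ → Admissible (T \ T₁) → T₁ = ∅ ∨ T \ T₁ = ∅ := by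
  constructor
  · intro h
    refine ⟨fun h' => h.not_isUnit ((hR.isUnit_iff ha).2 h'), fun T₁ hT₁ h1 h2 => ?_⟩
    obtain ⟨b, hb⟩ := hR.exists_rep _ h1
    obtain ⟨c, hc⟩ := hR.exists_rep _ h2
    have hbc := hR.mul hb hc Finset.disjoint_sdiff
    rw [Finset.union_sdiff_of_subset hT₁] at hbc
    have hirr := ((hR.rep_iff ha).1 hbc).irreducible h
    rw [← hR.isUnit_iff hb, ← hR.isUnit_iff hc]
    exact hirr.isUnit_or_isUnit rfl
  · rintro ⟨hne, h⟩
    refine ⟨fun hu => hne ((hR.isUnit_iff ha).1 hu), fun {b c} hbc => ?_⟩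
    subst hbc
    obtain ⟨T₁, hT₁, hb, hc⟩ := hR.split ha hT
    rw [hR.isUnit_iff hb, hR.isUnit_iff hc]
    exact h T₁ hT₁ (hR.admissible hb) (hR.admissible hc)

theorem irreducible_of_singleton {a : R} {i : Σ κ : Fin k, Fin (n κ - 1)} (ha : Rep a {some i}) :
    Irreducible a := by
  rw [hR.irreducible_iff ha]
  · refine ⟨by simp, fun T₁ hT₁ _ _ => ?_⟩
    rcases Finset.subset_singleton_iff.1 hT₁ with h | h
    · exact Or.inl h
    · exact Or.inr (by simp [h])
  · refine admissible_compl_of_subset_block (κ := i.1) ?_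
    rw [Finset.singleton_subset_iff, mem_block]

/-- In any splitting, the complement of the part with `none` lies in one block and contains block κ,
so it is block κ and the other part is empty. -/
theorem irreducible_of_compl_block (hk : 0 < k) (hn : ∀ κ, 1 < n κ) {a : R} {κ : Fin k}
    (ha : Rep a (block n κ)ᶜ) : Irreducible a := by
  have key : ∀ T₁ ⊆ (block n κ)ᶜ, none ∈ T₁ → Admissible T₁ → (block n κ)ᶜ \ T₁ = ∅ := by
    intro T₁ hT₁ h hadm
    obtain ⟨κ', hκ'⟩ := exists_compl_subset_block hk hadm h
    have hsub : block n κ ⊆ T₁ᶜ := Finset.subset_compl_comm.1 hT₁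
    have : κ = κ' := by
      obtain ⟨i, hi⟩ := block_nonempty hn κ
      have hi' := hκ' (hsub hi)
      match i, hi, hi' with
      | none, hi, _ => exact absurd hi none_notMem_block
      | some i, hi, hi' => exact (mem_block.1 hi).symm.trans (mem_block.1 hi')
    subst this
    rw [Finset.sdiff_eq_empty_iff_subset]
    exact compl_le_iff_compl_le.1 hκ'
  have hmem : none ∈ (block n κ)ᶜ := Finset.mem_compl.2 none_notMem_block
  rw [hR.irreducible_iff ha]
  · refine ⟨fun h => by simp [h] at hmem, fun T₁ hT₁ h1 h2 => ?_⟩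
    by_cases h : none ∈ T₁
    · exact Or.inr (key T₁ hT₁ h h1)
    · left
      have := key _ Finset.sdiff_subset (Finset.mem_sdiff.2 ⟨hmem, h⟩) h2
      rwa [Finset.sdiff_sdiff_eq_self hT₁] at this
  · rw [compl_compl]
    exact admissible_of_none_notMem none_notMem_block

theorem eq_singleton_of_irreducible {a : R} {T} (ha : Rep a T) {κ : Fin k} (hT : T ⊆ block n κ)
    (hirr : Irreducible a) : ∃ i, T = {i} := by
  rw [hR.irreducible_iff ha (admissible_compl_of_subset_block hT)] at hirr
  obtain ⟨i, hi⟩ := Finset.nonempty_iff_ne_empty.2 hirr.1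
  have hnone : none ∉ T := fun h => none_notMem_block (hT h)
  refine ⟨i, ?_⟩
  rcases hirr.2 {i} (Finset.singleton_subset_iff.2 hi)
    (admissible_of_none_notMem fun h => hnone (Finset.mem_singleton.1 h ▸ hi))
    (admissible_of_none_notMem fun h => hnone (Finset.mem_sdiff.1 h).1) with h | h
  · simp at h
  · exact (Finset.sdiff_eq_empty_iff_subset.1 h).antisymm (Finset.singleton_subset_iff.2 hi)

/-- The complement of T lies in some block; an index of that block still in T could be split off as
a singleton, the remainder staying admissible. -/
theorem eq_compl_block_of_irreducible (hk : 0 < k) {a : R} {T} (ha : Rep a T) (hnone : none ∈ T)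
    (hirr : Irreducible a) : ∃ κ, T = (block n κ)ᶜ := by
  obtain ⟨κ, hκ⟩ := exists_compl_subset_block hk (hR.admissible ha) hnone
  refine ⟨κ, (compl_le_iff_compl_le.1 hκ).antisymm' fun i hi => ?_⟩
  rw [hR.irreducible_iff ha (admissible_of_none_notMem fun h => Finset.mem_compl.1 h hnone)]
    at hirr
  rw [Finset.mem_compl]
  intro hib
  have hin : i ≠ none := fun h => none_notMem_block (h ▸ hib)
  have hsub : T \ (T \ {i}) = {i} := by
    rw [Finset.sdiff_sdiff_eq_self (Finset.singleton_subset_iff.2 hi)]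
  have h1 : Admissible (T \ {i}) := by
    rw [← compl_compl (T \ {i})]
    refine admissible_compl_of_subset_block (κ := κ) fun j hj => ?_
    rw [Finset.mem_compl, Finset.mem_sdiff, not_and_not_right] at hj
    by_cases hjT : j ∈ T
    · rwa [Finset.mem_singleton.1 (hj hjT)]
    · exact hκ (Finset.mem_compl.2 hjT)
  have h2 : Admissible (T \ (T \ {i})) := by
    rw [hsub]
    exact admissible_of_none_notMem fun h => hin (Finset.mem_singleton.1 h).symm
  rcases hirr.2 (T \ {i}) Finset.sdiff_subset h1 h2 with h | h
  · have := h ▸ Finset.mem_sdiff.2 ⟨hnone, fun h => hin (Finset.mem_singleton.1 h).symm⟩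
    simp at this
  · rw [hsub] at h
    simp at h

theorem rel_of_prod_rep {b : Option (Σ κ : Fin k, Fin (n κ - 1)) → R}
    (hb : ∀ i, i ≠ none → Rep (b i) {i}) {κ : Fin k} (s : Multiset R)
    (hs : ∀ a ∈ s, Irreducible a) {T} (hT : T ⊆ block n κ) (hsT : Rep s.prod T) :
    Multiset.Rel Associated s (T.val.map b) := by
  induction s using Multiset.induction_on generalizing T with
  | empty =>
    rw [Multiset.prod_zero] at hsT
    rw [hR.inj hsT hR.one]
    simp
  | cons y s ih =>
    rw [Multiset.prod_cons] at hsT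
    obtain ⟨T₁, hT₁, h1, h2⟩ := hR.split hsT (admissible_compl_of_subset_block hT)
    obtain ⟨i, rfl⟩ := hR.eq_singleton_of_irreducible h1 (hT₁.trans hT)
      (hs y (Multiset.mem_cons_self y s))
    have hi : i ∈ T := Finset.singleton_subset_iff.1 hT₁
    have hrel := ih (fun a ha => hs a (Multiset.mem_cons_of_mem ha))
      (Finset.sdiff_subset.trans hT) h2
    have hval : T.val = i ::ₘ (T \ {i}).val := by
      rw [Finset.sdiff_singleton_eq_erase, Finset.erase_val, Multiset.cons_erase hi]
    rw [hval, Multiset.map_cons]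
    refine Multiset.Rel.cons ?_ hrel
    exact (hR.rep_iff h1).1 (hb i fun h => none_notMem_block (hT (h ▸ hi)))

theorem prod_rep {b : Option (Σ κ : Fin k, Fin (n κ - 1)) → R}
    (hb : ∀ i, i ≠ none → Rep (b i) {i}) (T : Finset (Option (Σ κ : Fin k, Fin (n κ - 1))))
    (hT : none ∉ T) : Rep (T.val.map b).prod T := by
  change Rep (∏ i ∈ T, b i) T
  induction T using Finset.induction_on with
  | empty => simpa using hR.one
  | insert i T hi ih =>
    rw [Finset.prod_insert hi, Finset.insert_eq]
    rw [Finset.mem_insert, not_or] at hT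
    exact hR.mul (hb i (Ne.symm hT.1)) (ih hT.2) (Finset.disjoint_singleton_left.2 hi)

theorem exists_mem_rep (s : Multiset R) {T} (hs : Rep s.prod T) (hT : none ∈ T) :
    ∃ a ∈ s, ∃ T₁ ⊆ T, none ∈ T₁ ∧ Rep a T₁ := by
  induction s using Multiset.induction_on generalizing T with
  | empty =>
    rw [Multiset.prod_zero] at hs
    rw [hR.inj hs hR.one] at hT
    simp at hT
  | cons y s ih =>
    rw [Multiset.prod_cons] at hs
    obtain ⟨T₁, hT₁, h1, h2⟩ := hR.split hs
      (admissible_of_none_notMem fun h => Finset.mem_compl.1 h hT)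
    by_cases h : none ∈ T₁
    · exact ⟨y, Multiset.mem_cons_self y s, T₁, hT₁, h, h1⟩
    · obtain ⟨a, ha, T₂, hT₂, h⟩ := ih h2 (Finset.mem_sdiff.2 ⟨hT, h⟩)
      exact ⟨a, Multiset.mem_cons_of_mem ha, T₂, hT₂.trans Finset.sdiff_subset, h⟩

theorem exists_factorizations (hk : 0 < k) (hn : ∀ κ, 1 < n κ) :
    ∃ (r : R) (z : Fin k → Multiset R),
      (∀ i, IsFactorization r (z i) ∧ Multiset.card (z i) = n i) ∧
      (∀ i j, i ≠ j → ¬ EssentiallySame (z i) (z j)) ∧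
      (∀ s : Multiset R, IsFactorization r s → ∃ i, EssentiallySame s (z i)) := by
  have hadm : ∀ κ, Admissible (block n κ)ᶜ := fun κ =>
    admissible_compl_of_subset_block (Finset.Subset.refl _)
  obtain ⟨r, hr⟩ := hR.exists_rep Finset.univ fun _ i _ _ => Or.inl (Finset.mem_univ _)
  have hb : ∀ i : Option (Σ κ : Fin k, Fin (n κ - 1)), ∃ b, i ≠ none → Rep b {i} := by
    intro i
    by_cases hi : i = none
    · exact ⟨1, fun h => absurd hi h⟩
    · obtain ⟨b, hb⟩ := hR.exists_rep {i}
        (admissible_of_none_notMem fun h => hi (Finset.mem_singleton.1 h).symm)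
      exact ⟨b, fun _ => hb⟩
  choose b hb using hb
  have ha : ∀ κ, ∃ a, Rep a (block n κ)ᶜ ∧ a * ((block n κ).val.map b).prod = r := by
    intro κ
    obtain ⟨a, ha⟩ := hR.exists_rep _ (hadm κ)
    have h := hR.mul ha (hR.prod_rep hb (block n κ) none_notMem_block) disjoint_compl_left
    rw [Finset.union_comm, Finset.union_compl, hR.rep_iff hr] at h
    obtain ⟨u, hu⟩ := h.symm
    refine ⟨a * u, (hR.rep_iff ha).2 ⟨u, rfl⟩, ?_⟩
    rw [← hu]
    ring
  choose a ha har using ha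
  refine ⟨r, fun κ => a κ ::ₘ (block n κ).val.map b, fun κ => ⟨⟨fun x hx => ?_, ?_⟩, ?_⟩,
    fun κ κ' hne hsame => ?_, fun s hs => ?_⟩
  · rcases Multiset.mem_cons.1 hx with rfl | hx
    · exact hR.irreducible_of_compl_block hk hn (ha κ)
    · obtain ⟨i, hi, rfl⟩ := Multiset.mem_map.1 hx
      match i, hi with
      | none, hi => exact absurd hi none_notMem_block
      | some i, hi => exact hR.irreducible_of_singleton (hb (some i) (by simp))
  · rw [Multiset.prod_cons, har]
  · have : (block n κ).card = n κ - 1 := by simp [block]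
    rw [Multiset.card_cons, Multiset.card_map, Finset.card_val, this]
    have := hn κ
    omega
  · obtain ⟨x, hx, hax⟩ := Multiset.exists_mem_of_rel_of_mem hsame (Multiset.mem_cons_self _ _)
    have hrep := (hR.rep_iff (ha κ)).2 hax
    rcases Multiset.mem_cons.1 hx with rfl | hx
    · exact hne (block_injective hn (compl_injective (hR.inj hrep (ha κ'))))
    · obtain ⟨i, hi, rfl⟩ := Multiset.mem_map.1 hx
      have hin : i ≠ none := fun h => none_notMem_block (h ▸ hi)
      have h := hR.inj hrep (hb i hin)
      have hmem : none ∈ (block n κ)ᶜ := Finset.mem_compl.2 none_notMem_block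
      rw [h] at hmem
      exact hin (Finset.mem_singleton.1 hmem).symm
  · obtain ⟨hirr, hprod⟩ := hs
    obtain ⟨x, hx, T, -, hnone, hrep⟩ := hR.exists_mem_rep s (hprod ▸ hr) (Finset.mem_univ _)
    obtain ⟨κ, rfl⟩ := hR.eq_compl_block_of_irreducible hk hrep hnone (hirr x hx)
    refine ⟨κ, ?_⟩
    obtain ⟨s, rfl⟩ := Multiset.exists_cons_of_mem hx
    rw [Multiset.prod_cons] at hprod
    obtain ⟨T₁, -, h1, h2⟩ := hR.split (T := Finset.univ) (hprod ▸ hr)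
      (admissible_of_none_notMem (by simp))
    rw [hR.inj h1 hrep, ← Finset.compl_eq_univ_sdiff, compl_compl] at h2
    exact Multiset.Rel.cons ((hR.rep_iff hrep).1 (ha κ))
      (hR.rel_of_prod_rep hb s (fun y hy => hirr y (Multiset.mem_cons_of_mem hy))
        (Finset.Subset.refl _) h2)

end IsSetRepresentation

end Combinatorics

/-! ### Integer-valued products -/

section Corrections

/-- Corrections `δ i c ∈ {1, 2}` for which the sets of indices whose total correction is maximal
at `0` are precisely the admissible ones. -/
theorem exists_corrections {k : ℕ} {n : Fin k → ℕ} {Q : Type*} [Zero Q]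
    (pt : (Σ κ : Fin k, Fin (n κ - 1)) × (Σ κ : Fin k, Fin (n κ - 1)) → Q)
    (hpt : Function.Injective pt) (h0 : ∀ p, pt p ≠ 0) :
    ∃ δ : Option (Σ κ : Fin k, Fin (n κ - 1)) → Q → ℕ,
      (∀ i c, 0 < δ i c ∧ δ i c < 3) ∧
      ∀ T : Finset (Option (Σ κ : Fin k, Fin (n κ - 1))),
        (∀ c, ∑ i ∈ T, δ i c ≤ ∑ i ∈ T, δ i 0) ↔ Admissible T := by
  classical
  -- Relative to 0, at the point marked by a pair from different blocks the correction of `none`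
  -- rises from 1 to 2, while that of each member of the pair drops from 2 to 1. The total exceeds
  -- that at 0 exactly when `none` is present and both members are absent.
  let δ : Option (Σ κ : Fin k, Fin (n κ - 1)) → Q → ℕ := fun i c =>
    i.elim (if ∃ i j : Σ κ : Fin k, Fin (n κ - 1), i.1 ≠ j.1 ∧ c = pt (i, j) then 2 else 1)
      fun i => if ∃ j : Σ κ : Fin k, Fin (n κ - 1), i.1 ≠ j.1 ∧ (c = pt (i, j) ∨ c = pt (j, i))
        then 1 else 2
  have hnone0 : δ none 0 = 1 := if_neg (by rintro ⟨i, j, -, h⟩; exact h0 _ h.symm)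
  have hsome0 : ∀ i, δ (some i) 0 = 2 := fun i =>
    if_neg (by rintro ⟨j, -, h | h⟩ <;> exact h0 _ h.symm)
  have hsome2 : ∀ i c, δ (some i) c ≤ 2 := by
    intro i c
    change (if _ then 1 else 2) ≤ 2
    split_ifs <;> norm_num
  have hmark : ∀ i j : Σ κ : Fin k, Fin (n κ - 1), i.1 ≠ j.1 → δ none (pt (i, j)) = 2 :=
    fun i j hij => if_pos ⟨i, j, hij, rfl⟩
  refine ⟨δ, fun i c => ?_, fun T => ⟨fun h hnone i j hij => ?_, fun h c => ?_⟩⟩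
  · cases i
    · change 0 < (if _ then 2 else 1) ∧ (if _ then 2 else 1) < 3
      split_ifs <;> norm_num
    · change 0 < (if _ then 1 else 2) ∧ (if _ then 1 else 2) < 3
      split_ifs <;> norm_num
  · by_contra! hT
    refine (h (pt (i, j))).not_gt (Finset.sum_lt_sum (fun l hl => ?_) ⟨none, hnone, ?_⟩)
    · match l, hl with
      | none, _ => rw [hnone0, hmark i j hij]; norm_num
      | some l, hl =>
        rw [hsome0]
        refine (if_neg ?_).ge
        rintro ⟨l', -, h | h⟩
        · have : i = l := congrArg Prod.fst (hpt h)
          exact hT.1 (this ▸ hl)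
        · have : j = l := congrArg Prod.snd (hpt h)
          exact hT.2 (this ▸ hl)
    · rw [hnone0, hmark i j hij]; norm_num
  · by_cases hc : none ∈ T ∧ ∃ i j : Σ κ : Fin k, Fin (n κ - 1), i.1 ≠ j.1 ∧ c = pt (i, j)
    · obtain ⟨hnone, i, j, hij, rfl⟩ := hc
      obtain ⟨l, hl, hl1⟩ : ∃ l, some l ∈ T ∧ δ (some l) (pt (i, j)) = 1 := by
        rcases h hnone i j hij with hi | hj
        · exact ⟨i, hi, if_pos ⟨j, hij, Or.inl rfl⟩⟩
        · exact ⟨j, hj, if_pos ⟨i, hij.symm, Or.inr rfl⟩⟩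
      have hl' : some l ∈ T.erase none := Finset.mem_erase.2 ⟨by simp, hl⟩
      rw [← Finset.add_sum_erase T _ hnone, ← Finset.add_sum_erase T _ hnone,
        ← Finset.add_sum_erase (T.erase none) _ hl', ← Finset.add_sum_erase (T.erase none) _ hl',
        hmark i j hij, hl1, hnone0, hsome0]
      have : ∑ x ∈ (T.erase none).erase (some l), δ x (pt (i, j)) ≤
          ∑ x ∈ (T.erase none).erase (some l), δ x 0 := by
        refine Finset.sum_le_sum fun x hx => ?_
        match x, hx with
        | none, hx => simp at hx
        | some x, _ => rw [hsome0]; exact hsome2 x _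
      omega
    · refine Finset.sum_le_sum fun x hx => ?_
      match x, hx with
      | none, hx =>
        rw [hnone0]
        exact (if_neg fun h => hc ⟨hx, h⟩).le
      | some x, _ => rw [hsome0]; exact hsome2 x _

end Corrections

/-! ### Units, associates and unique factorization in K[X] -/

section Units

variable {D K : Type*} [CommRing D] [Field K] [Algebra D K] [IsFractionRing D K]

/-- Both factors are constants by degree; their values at 0 lie in D and multiply to a unit of D. -/
theorem exists_units_of_mul_eq_C {f g : K[X]} {u : Dˣ} (h : C (algebraMap D K u) = f * g)
    (hf : f.eval 0 ∈ (algebraMap D K).range) (hg : g.eval 0 ∈ (algebraMap D K).range) :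
    ∃ v w : Dˣ, f = C (algebraMap D K v) ∧ g = C (algebraMap D K w) := by
  have hu : IsUnit (C (algebraMap D K u)) := isUnit_C.2 (u.isUnit.map _)
  rw [h, IsUnit.mul_iff] at hu
  obtain ⟨⟨x, -, rfl⟩, ⟨y, -, rfl⟩⟩ := And.imp isUnit_iff.1 isUnit_iff.1 hu
  simp only [eval_C] at hf hg
  obtain ⟨x, rfl⟩ := hf
  obtain ⟨y, rfl⟩ := hg
  rw [← C_mul, ← map_mul] at h
  have hxy := IsFractionRing.injective D K (C_injective h)
  have hx : IsUnit (x * y) := hxy ▸ u.isUnit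
  obtain ⟨⟨v, rfl⟩, ⟨w, rfl⟩⟩ := IsUnit.mul_iff.1 hx
  exact ⟨v, w, rfl, rfl⟩

end Units

section Products

variable {D K : Type*} [CommRing D] [IsDomain D] [Field K] [Algebra D K] [IsFractionRing D K]

theorem C_algebraMap_mem (r : D) : C (algebraMap D K r) ∈ integerValuedPolynomials D K :=
  (integerValuedPolynomials D K).algebraMap_mem r

theorem eval_zero_mem_range {f : K[X]} (hf : f ∈ integerValuedPolynomials D K) :
    f.eval 0 ∈ (algebraMap D K).range := by
  simpa using hf 0

theorem C_unit_mul_mem_iff {f : K[X]} (u : Dˣ) :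
    C (algebraMap D K u) * f ∈ integerValuedPolynomials D K ↔
      f ∈ integerValuedPolynomials D K := by
  refine ⟨fun h => ?_, fun h => mul_mem (C_algebraMap_mem _) h⟩
  have := mul_mem (C_algebraMap_mem ((u⁻¹ : Dˣ) : D)) h
  rwa [← mul_assoc, ← C_mul, ← map_mul, Units.inv_mul, map_one, C_1, one_mul] at this

theorem exists_unit_of_associated {a b : integerValuedPolynomials D K} (h : Associated a b) :
    ∃ u : Dˣ, (b : K[X]) = C (algebraMap D K u) * a := by
  obtain ⟨v, rfl⟩ := h
  have hv : (C (algebraMap D K ((1 : Dˣ) : D))) =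
      ((v : integerValuedPolynomials D K) : K[X]) *
        ((v⁻¹ : (integerValuedPolynomials D K)ˣ) : integerValuedPolynomials D K) := by
    rw [← MulMemClass.coe_mul, Units.mul_inv]
    simp
  obtain ⟨u, -, hu, -⟩ := exists_units_of_mul_eq_C hv (eval_zero_mem_range (SetLike.coe_mem _))
    (eval_zero_mem_range (SetLike.coe_mem _))
  exact ⟨u, by rw [MulMemClass.coe_mul, hu, mul_comm]⟩

theorem associated_of_unit {a b : integerValuedPolynomials D K} (u : Dˣ)
    (h : (b : K[X]) = C (algebraMap D K u) * a) : Associated a b := by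
  refine ⟨u.map (algebraMap D (integerValuedPolynomials D K)).toMonoidHom, Subtype.ext ?_⟩
  rw [h, mul_comm]
  rfl

variable {k : ℕ} {n : Fin k → ℕ} {Q : Type*} [Fintype Q] [DecidableEq Q]

/-- Normalized irreducible polynomials indexed by `ι × Q`, whose integer-valued products are
controlled by the admissible subsets of `ι`, provide a set representation. -/
theorem isSetRepresentation_of_products (g : Option (Σ κ : Fin k, Fin (n κ - 1)) × Q → K[X])
    (hirr : ∀ p, Irreducible (g p)) (h0 : ∀ p, (g p).eval 0 = 1)
    (hinj : ∀ T T' : Finset (Option (Σ κ : Fin k, Fin (n κ - 1))),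
      (∏ p ∈ T ×ˢ Finset.univ, g p).natDegree = (∏ p ∈ T' ×ˢ Finset.univ, g p).natDegree → T = T')
    (hadm : ∀ T : Finset (Option (Σ κ : Fin k, Fin (n κ - 1))),
      ∏ p ∈ T ×ˢ Finset.univ, g p ∈ integerValuedPolynomials D K ↔ Admissible T)
    (hglue : ∀ S, ∏ p ∈ S, g p ∈ integerValuedPolynomials D K →
      ∏ p ∈ Sᶜ, g p ∈ integerValuedPolynomials D K → ∃ T, S = T ×ˢ Finset.univ) :
    IsSetRepresentation fun (a : integerValuedPolynomials D K) T =>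
      ∃ u : Dˣ, (a : K[X]) = C (algebraMap D K u) * ∏ p ∈ T ×ˢ Finset.univ, g p where
  exists_rep T hT := ⟨⟨_, (hadm T).2 hT⟩, 1, by simp⟩
  admissible := by
    rintro a T ⟨u, hu⟩
    rw [← hadm, ← C_unit_mul_mem_iff u, ← hu]
    exact a.2
  rep_iff := by
    rintro a b T ⟨u, hu⟩
    constructor
    · rintro ⟨v, hv⟩
      refine associated_of_unit (v * u⁻¹) ?_
      rw [hv, hu, ← mul_assoc, ← C_mul, ← map_mul, ← Units.val_mul, inv_mul_cancel_right]
    · intro h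
      obtain ⟨v, hv⟩ := exists_unit_of_associated h
      exact ⟨v * u, by rw [hv, hu, ← mul_assoc, ← C_mul, ← map_mul, ← Units.val_mul]⟩
  inj := by
    rintro a T T' ⟨u, hu⟩ ⟨v, hv⟩
    have hne : ∀ u : Dˣ, algebraMap D K u ≠ 0 := fun u => (u.isUnit.map (algebraMap D K)).ne_zero
    apply hinj
    rw [← natDegree_C_mul (hne u), ← hu, hv, natDegree_C_mul (hne v)]
  one := ⟨1, by simp⟩
  mul := by
    rintro a b T T' ⟨u, hu⟩ ⟨v, hv⟩ hdisj
    refine ⟨u * v, ?_⟩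
    rw [Finset.union_product, Finset.prod_union (Finset.disjoint_product.2 (Or.inl hdisj)),
      MulMemClass.coe_mul, hu, hv, Units.val_mul, map_mul, C_mul]
    ring
  split := by
    rintro a b T ⟨u, hu⟩ hT
    rw [MulMemClass.coe_mul] at hu
    -- Unique factorization in K[X] distributes the irreducibles over the two factors. Since each
    -- takes the value 1 at 0, the cofactors f and f' have values at 0 in D and so are units of D.
    obtain ⟨s, s', f, f', hss', hdisj, huf, ha, hb⟩ :=
      mul_eq_mul_prime_prod (fun p _ => (hirr p).prime) hu
    have heval : ∀ (f : K[X]) (s : Finset (Option (Σ κ : Fin k, Fin (n κ - 1)) × Q)),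
        (f * ∏ p ∈ s, g p).eval 0 = f.eval 0 := by
      intro f s
      rw [eval_mul, eval_prod, Finset.prod_congr rfl fun p _ => h0 p, Finset.prod_const_one,
        mul_one]
    obtain ⟨v, v', rfl, rfl⟩ := exists_units_of_mul_eq_C huf
      (by rw [← heval f s, ← ha]; exact eval_zero_mem_range a.2)
      (by rw [← heval f' s', ← hb]; exact eval_zero_mem_range b.2)
    have hs : ∏ p ∈ s, g p ∈ integerValuedPolynomials D K := by
      rw [← C_unit_mul_mem_iff v, ← ha]
      exact a.2
    have hs' : ∏ p ∈ s', g p ∈ integerValuedPolynomials D K := by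
      rw [← C_unit_mul_mem_iff v', ← hb]
      exact b.2
    -- Here admissibility of the complement of T enters: it makes the product over the whole
    -- complement of s integer-valued, as `hglue` requires.
    have hcompl : sᶜ = s' ∪ Tᶜ ×ˢ Finset.univ := by
      ext p
      have h1 : p ∈ s ∨ p ∈ s' ↔ p.1 ∈ T := by
        rw [← Finset.mem_union, hss', Finset.mem_product]
        simp
      have h2 : p ∈ s → p ∉ s' := fun h h' => Finset.disjoint_left.1 hdisj h h'
      simp only [Finset.mem_compl, Finset.mem_union, Finset.mem_product, Finset.mem_univ, and_true]
      tauto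
    have hdisj' : Disjoint s' (Tᶜ ×ˢ (Finset.univ : Finset Q)) := by
      rw [Finset.disjoint_left]
      intro p hp hp'
      have : p ∈ T ×ˢ (Finset.univ : Finset Q) := hss' ▸ Finset.mem_union_right s hp
      exact Finset.mem_compl.1 (Finset.mem_product.1 hp').1 (Finset.mem_product.1 this).1
    obtain ⟨T₁, rfl⟩ := hglue s hs (by
      rw [hcompl, Finset.prod_union hdisj']
      exact mul_mem hs' ((hadm _).2 hT))
    by_cases hQ : Nonempty Q
    · obtain ⟨c⟩ := hQ
      have hsub : T₁ ⊆ T := by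
        intro i hi
        have : (i, c) ∈ T ×ˢ (Finset.univ : Finset Q) :=
          hss' ▸ Finset.mem_union_left s' (Finset.mem_product.2 ⟨hi, Finset.mem_univ c⟩)
        exact (Finset.mem_product.1 this).1
      refine ⟨T₁, hsub, ⟨v, ha⟩, v', ?_⟩
      rw [hb]
      congr 2
      ext p
      have h1 : p ∈ T₁ ×ˢ (Finset.univ : Finset Q) ∨ p ∈ s' ↔ p ∈ T ×ˢ Finset.univ := by
        rw [← hss', Finset.mem_union]
      have h2 : p ∈ T₁ ×ˢ (Finset.univ : Finset Q) → p ∉ s' :=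
        fun h h' => Finset.disjoint_left.1 hdisj h h'
      simp only [Finset.mem_product, Finset.mem_univ, and_true, Finset.mem_sdiff] at h1 h2 ⊢
      tauto
    · rw [not_nonempty_iff] at hQ
      refine ⟨∅, Finset.empty_subset _, ⟨v, ?_⟩, v', ?_⟩
      · rw [ha]; simp
      · rw [hb]; simp [Finset.univ_eq_empty, Finset.eq_empty_of_isEmpty s']

end Products

/-! ### Assembling the polynomials over the finite ring D/π^M -/

section FiniteResidueField

variable {D : Type*} [CommRing D]

theorem isMaximal_span_of_finite {π : D} (hπ : Prime π) (hfin : Finite (D ⧸ Ideal.span {π})) :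
    (Ideal.span {π}).IsMaximal := by
  have := (Ideal.span_singleton_prime hπ.ne_zero).2 hπ
  exact Ideal.Quotient.maximal_of_isField _ (Finite.isField_of_domain _)

theorem finite_quotient_span_pow {π : D} (hfin : Finite (D ⧸ Ideal.span {π})) (M : ℕ) :
    Finite (D ⧸ Ideal.span {π ^ M}) := by
  rw [← Ideal.span_singleton_pow]
  exact Ideal.finite_quotient_pow (Submodule.fg_span_singleton π) M

end FiniteResidueField

section Construction

variable {D K : Type*} [CommRing D] [IsDomain D] [Field K] [Algebra D K] [IsFractionRing D K]

theorem prod_mem_integerValuedPolynomials_iff {π : D} (hπ : Prime π) {M : ℕ}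
    {J : Type*} (g : J → K[X]) (v : J → D ⧸ Ideal.span {π ^ M} → ℕ)
    (hg : ∀ p, ∀ a : D, ∃ y : D, ¬ π ∣ y ∧
      (g p).eval (algebraMap D K a) * algebraMap D K (π ^ v p 0) =
        algebraMap D K (π ^ v p (Ideal.Quotient.mk _ a) * y)) (S : Finset J) :
    ∏ p ∈ S, g p ∈ integerValuedPolynomials D K ↔ ∀ a, ∑ p ∈ S, v p 0 ≤ ∑ p ∈ S, v p a := by
  have hinj := IsFractionRing.injective D K
  choose y hy hgy using hg
  have hyS : ∀ a, ¬ π ∣ ∏ p ∈ S, y p a := by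
    intro a h
    obtain ⟨p, -, hp⟩ := (hπ.dvd_finsetProd_iff _).1 h
    exact hy p a hp
  have heval : ∀ a : D, (∏ p ∈ S, g p).eval (algebraMap D K a) *
      algebraMap D K (π ^ ∑ p ∈ S, v p 0) =
        algebraMap D K (π ^ (∑ p ∈ S, v p (Ideal.Quotient.mk _ a)) * ∏ p ∈ S, y p a) := by
    intro a
    rw [eval_prod, ← Finset.prod_pow_eq_pow_sum, ← Finset.prod_pow_eq_pow_sum, map_prod,
      ← Finset.prod_mul_distrib, ← Finset.prod_mul_distrib, map_prod]
    exact Finset.prod_congr rfl fun p _ => hgy p a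
  constructor
  · intro h a
    obtain ⟨a, rfl⟩ := Ideal.Quotient.mk_surjective a
    obtain ⟨r, hr⟩ := h a
    have h1 := heval a
    rw [← hr, ← map_mul] at h1
    have h2 := hinj h1
    by_contra! hlt
    obtain ⟨d, hd⟩ := Nat.exists_eq_add_of_lt hlt
    rw [hd, add_assoc, pow_add, mul_left_comm] at h2
    have h3 := mul_left_cancel₀ (pow_ne_zero _ hπ.ne_zero) h2
    apply hyS a
    rw [← h3, pow_succ]
    exact Dvd.intro_left (r * π ^ d) (by ring)
  · intro h a
    obtain ⟨d, hd⟩ := Nat.exists_eq_add_of_le (h (Ideal.Quotient.mk _ a))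
    refine ⟨π ^ d * ∏ p ∈ S, y p a, ?_⟩
    have hne : algebraMap D K (π ^ ∑ p ∈ S, v p 0) ≠ 0 := by
      rw [Ne, map_eq_zero_iff _ hinj]
      exact pow_ne_zero _ hπ.ne_zero
    apply mul_right_cancel₀ hne
    rw [heval a, hd, ← map_mul, pow_add]
    congr 1
    ring

theorem mk_pow_inj {π : D} (hπ : Prime π) {M i j : ℕ} (hi : i < M) (hj : j < M)
    (h : Ideal.Quotient.mk (Ideal.span {π ^ M}) π ^ i =
      Ideal.Quotient.mk (Ideal.span {π ^ M}) π ^ j) : i = j := by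
  wlog hij : i < j generalizing i j
  · rcases eq_or_lt_of_le (not_lt.1 hij) with h' | h'
    exacts [h'.symm, (this hj hi h.symm h').symm]
  exfalso
  rw [← map_pow, ← map_pow, Ideal.Quotient.mk_eq_mk_iff_sub_mem, Ideal.mem_span_singleton] at h
  have h1 := (pow_dvd_pow π (Nat.succ_le_iff.2 hi)).trans h
  rw [dvd_sub_left (pow_dvd_pow π hij), pow_dvd_pow_iff hπ.ne_zero hπ.not_isUnit] at h1
  omega

theorem mk_pow_ne_zero {π : D} (hπ : Prime π) {M i : ℕ} (hi : i < M) :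
    Ideal.Quotient.mk (Ideal.span {π ^ M}) π ^ i ≠ 0 := by
  rw [← map_pow, Ne, Ideal.Quotient.eq_zero_iff_mem, Ideal.mem_span_singleton,
    pow_dvd_pow_iff hπ.ne_zero hπ.not_isUnit]
  omega

theorem exists_irreducible_binomVal_mk (hD : IsKrullDomain D) {π : D} (hπ : Prime π)
    (hmax : (Ideal.span {π}).IsMaximal) {M l δ : ℕ} (hM : 0 < M) (hl : 0 < l) (hδ : 0 < δ)
    (hδ3 : δ < 3) (c : D ⧸ Ideal.span {π ^ M}) :
    ∃ g : K[X], Irreducible g ∧ g.natDegree = 3 ^ l ∧ g.eval 0 = 1 ∧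
      ∀ a : D, ∃ y : D, ¬ π ∣ y ∧
        g.eval (algebraMap D K a) * algebraMap D K
          (π ^ binomVal (Ideal.Quotient.mk (Ideal.span {π ^ M}) π) M (3 ^ l) δ (0 - c)) =
        algebraMap D K (π ^ binomVal (Ideal.Quotient.mk (Ideal.span {π ^ M}) π) M (3 ^ l) δ
          (Ideal.Quotient.mk _ a - c) * y) := by
  obtain ⟨c, rfl⟩ := Ideal.Quotient.mk_surjective c
  obtain ⟨g, h1, h2, h3, h4⟩ := exists_irreducible_binomVal (K := K) hD hπ hmax hM hl hδ hδ3 c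
  refine ⟨g, h1, h2, h3, fun a => ?_⟩
  rw [← map_zero (Ideal.Quotient.mk (Ideal.span {π ^ M})), ← map_sub, ← map_sub, binomVal_mk,
    binomVal_mk]
  exact h4 a

theorem exists_isSetRepresentation (hD : IsKrullDomain D) {π : D} (hπ : Prime π)
    (hfin : Finite (D ⧸ Ideal.span {π})) {k : ℕ} (n : Fin k → ℕ) :
    ∃ Rep : integerValuedPolynomials D K →
      Finset (Option (Σ κ : Fin k, Fin (n κ - 1))) → Prop, IsSetRepresentation Rep := by
  classical
  let σ := Σ κ : Fin k, Fin (n κ - 1)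
  -- M exceeds the number of pairs, so that distinct powers of π below π^M can mark them by distinct
  -- nonzero classes.
  obtain ⟨M, hMcard⟩ : ∃ M, Fintype.card (σ × σ) < M := exists_gt _
  have hM : 0 < M := Nat.zero_lt_of_lt hMcard
  obtain ⟨L, hL0, hL⟩ : ∃ L, 0 < L ∧ 2 * Fintype.card (Option σ) < 3 ^ L :=
    ⟨2 * Fintype.card (Option σ) + 1, Nat.succ_pos _,
      (Nat.lt_succ_self _).trans (Nat.lt_pow_self (by norm_num))⟩
  obtain ⟨e, he⟩ : ∃ e : Option σ → ℕ, Function.Injective e :=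
    ⟨_, Fin.val_injective.comp (Fintype.equivFin (Option σ)).injective⟩
  have := finite_quotient_span_pow hfin M
  have : Fintype (D ⧸ Ideal.span {π ^ M}) := Fintype.ofFinite _
  let t := Ideal.Quotient.mk (Ideal.span {π ^ M}) π
  have ht : t ^ M = 0 := mk_pow_self π M
  have hlt : ∀ p, (Fintype.equivFin (σ × σ) p : ℕ) < M := fun p =>
    (Fin.is_lt _).trans hMcard
  obtain ⟨δ, hδ, hadm⟩ := exists_corrections (n := n)
    (fun p => t ^ (Fintype.equivFin (σ × σ) p : ℕ))
    (fun p q h => (Fintype.equivFin _).injective (Fin.ext (mk_pow_inj hπ (hlt p) (hlt q) h)))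
    (fun p => mk_pow_ne_zero hπ (hlt p))
  have hgex : ∀ p : Option σ × (D ⧸ Ideal.span {π ^ M}), ∃ g : K[X], Irreducible g ∧
      g.natDegree = 3 ^ (L + e p.1) ∧ g.eval 0 = 1 ∧ ∀ a : D, ∃ y : D, ¬ π ∣ y ∧
        g.eval (algebraMap D K a) *
          algebraMap D K (π ^ binomVal t M (3 ^ (L + e p.1)) (δ p.1 p.2) (0 - p.2)) =
        algebraMap D K (π ^ binomVal t M (3 ^ (L + e p.1)) (δ p.1 p.2)
          (Ideal.Quotient.mk _ a - p.2) * y) := by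
    rintro ⟨i, c⟩
    exact exists_irreducible_binomVal_mk hD hπ (isMaximal_span_of_finite hπ hfin) hM
      (l := L + e i) (by omega) (hδ i c).1 (hδ i c).2 c
  choose g hirr hdeg h0 hval using hgex
  have hmem : ∀ S, ∏ p ∈ S, g p ∈ integerValuedPolynomials D K ↔
      ∀ a, totalVal t M (fun i => 3 ^ (L + e i)) δ S 0 ≤
        totalVal t M (fun i => 3 ^ (L + e i)) δ S a :=
    prod_mem_integerValuedPolynomials_iff hπ g
      (fun p a => binomVal t M (3 ^ (L + e p.1)) (δ p.1 p.2) (a - p.2)) hval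
  refine ⟨_, isSetRepresentation_of_products g hirr h0 (fun T T' h => ?_) (fun T => ?_)
    fun S h1 h2 => ?_⟩
  -- The degree determines T, again by base-3 expansion.
  · have hsum : ∀ T : Finset (Option σ), (∏ p ∈ T ×ˢ Finset.univ, g p).natDegree =
        Fintype.card (D ⧸ Ideal.span {π ^ M}) * 3 ^ L * ∑ j ∈ T.image e, 3 ^ j := by
      intro T
      rw [natDegree_prod _ _ fun p _ => (hirr p).ne_zero, Finset.sum_product,
        Finset.sum_image fun _ _ _ _ h => he h, Finset.mul_sum]
      refine Finset.sum_congr rfl fun i _ => ?_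
      simp [hdeg, pow_add, mul_assoc]
    rw [hsum, hsum] at h
    have h := Nat.eq_of_mul_eq_mul_left (Nat.mul_pos Fintype.card_pos (by positivity)) h
    exact Finset.image_injective he (Finset.geomSum_injective (by norm_num) h)
  · rw [hmem, ← hadm]
    refine forall_congr' fun a => totalVal_product_le_iff ht (fun i c => ?_) T a
    have h1 : 3 ≤ 3 ^ (L + e i) := Nat.le_self_pow (by omega) 3
    have h2 := Nat.le_mul_of_pos_right (3 ^ (L + e i)) hM
    have h3 := (hδ i c).2
    omega
  · exact exists_eq_product_of_totalVal_le hM ht he hL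
      (fun i c => Nat.le_of_lt_succ (hδ i c).2) ((hmem S).1 h1) ((hmem Sᶜ).1 h2)

end Construction

theorem mainTheorem1 (D K : Type*) [CommRing D] [IsDomain D] [Field K] [Algebra D K]
    [IsFractionRing D K] (hD : IsKrullDomain D) (π : D) (hπ : Prime π)
    (hfin : Finite (D ⧸ Ideal.span {π})) :
    HasFullSystemOfMultisetsOfLengths (integerValuedPolynomials D K) := by
  intro k hk n _ hn
  obtain ⟨Rep, hRep⟩ := exists_isSetRepresentation (K := K) hD hπ hfin n
  exact hRep.exists_factorizations hk hn
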